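/- Let $d\ge 3$ be odd. A \emph{representation of the Clifford relations} is a $d$-tuple $(\gamma_1,\dots,\gamma_d)$ of Hermitian matrices in $M_n(\mathbb{C})$ with $\gamma_j^2=I$ for all $j$ and $\gamma_j\gamma_k=-\gamma_k\gamma_j$ for $j\ne k$; it is \emph{irreducible} if $n>0$ and $\{0\}$ and $\mathbb{C}^n$ are the only subspaces of $\mathbb{C}^n$ invariant under all $\gamma_j$. Let $\mathcal{C}\ell(d)$ be the complex Clifford algebra with universal generators $e_1,\dots,e_d$ ($e_j^2=1$, $e_je_k=-e_ke_j$ for $j\neq k$). The \emph{Clifford spectrum} $\Lambda(A_1,\dots,A_d)$ of Hermitian matrices $A_1,\dots,A_d\in M_n(\mathbb{C})$ is the set of $\boldsymbol\lambda\in\mathbb{R}^d$ for which $\sum_{j}(A_j-\lambda_j I)\otimes e_j$ is not invertible in $M_n(\mathbb{C})\otimes\mathcal{C}\ell(d)$. For a representation $\rho=(\rho_1,\dots,\rho_d)$ of the Clifford relations put $L^{\rho}_{\boldsymbol\lambda}(A_1,\dots,A_d)=\sum_{j}(A_j-\lambda_j I)\otimes\rho_j$, a Hermitian matrix. The signature $\mathrm{sig}$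 of a Hermitian matrix is the number of its positive eigenvalues minus the number of its negative eigenvalues, counted with multiplicity. Let $\gamma=(\gamma_1,\dots,\gamma_d)$ be an irreducible representation of the Clifford relations. Then $\Lambda(\gamma_1,\dots,\gamma_d)=S^{d-1}$, the unit sphere in $\mathbb{R}^d$. Moreover, with $\rho=\gamma$, $$\mathrm{sig}\left(L^{\rho}_{\boldsymbol\lambda}(\gamma_1,\dots,\gamma_d)\right)=\begin{cases}\dbinom{d-1}{(d-1)/2} & \text{if } |\boldsymbol\lambda|<1,\\[1ex] 0 & \text{if } |\boldsymbol\lambda|>1.\end{cases}$$ The same formula holds for every irreducible representation $\rho$ of the Clifford relations that follows the same sign convention as $\gamma$, that is, such that $\gamma_d=\epsilon\,\gamma_{d-1}\cdots\gamma_2\gamma_1$ and $\rho_d=\epsilon\,\rho_{d-1}\cdots\rho_2\rho_1$ for one and the same scalar $\epsilon\in\mathbb{C}$ (for example $\epsilon=i^{(d-1)/2}$). -/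

import Mathlib

open scoped TensorProduct Kronecker

noncomputable section

namespace CliffordSpec

/-- The quadratic form `∑ j, x_j ^ 2` on `ℂ ^ d`. -/
def stdForm (d : ℕ) : QuadraticForm ℂ (Fin d → ℂ) :=
  QuadraticMap.weightedSumSquares ℂ (fun _ : Fin d => (1 : ℂ))

/-- The complex Clifford algebra with `d` generators. -/
abbrev Cl (d : ℕ) : Type := CliffordAlgebra (stdForm d)

/-- The universal Clifford generators `e_1, …, e_d`. -/
def gen {d : ℕ} (j : Fin d) : Cl d :=
  CliffordAlgebra.ι (stdForm d) (Pi.single j 1)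

theorem gen_sq {d : ℕ} (j : Fin d) : (gen j : Cl d) * gen j = 1 := by
  have h : stdForm d (Pi.single j 1) = 1 := by
    simp [stdForm, QuadraticMap.weightedSumSquares_apply, Pi.single_apply]
  rw [gen, CliffordAlgebra.ι_sq_scalar, h, map_one]

theorem gen_anticomm {d : ℕ} {j k : Fin d} (h : j ≠ k) :
    (gen j : Cl d) * gen k = -(gen k * gen j) := by
  refine eq_neg_of_add_eq_zero_left ?_
  rw [gen, gen, CliffordAlgebra.ι_mul_ι_add_swap]
  have : QuadraticMap.polar (stdForm d) (Pi.single j 1) (Pi.single k 1) = 0 := by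
    simp only [QuadraticMap.polar, stdForm, QuadraticMap.weightedSumSquares_apply, Pi.add_apply,
      ← Finset.sum_sub_distrib]
    refine Finset.sum_eq_zero fun i _ => ?_
    by_cases h1 : i = j <;> by_cases h2 : i = k <;> simp_all
  rw [this, map_zero]

/-- The spectral localizer `∑ j, (A_j - λ_j) ⊗ e_j` in `M_n(ℂ) ⊗ Cℓ(d)`. -/
def universalLocalizer {d n : ℕ} (A : Fin d → Matrix (Fin n) (Fin n) ℂ)
    (x : EuclideanSpace ℝ (Fin d)) : Matrix (Fin n) (Fin n) ℂ ⊗[ℂ] Cl d :=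
  ∑ j, (A j - ((x j : ℝ) : ℂ) • (1 : Matrix (Fin n) (Fin n) ℂ)) ⊗ₜ[ℂ] (gen j : Cl d)

/-- The Clifford spectrum `Λ(A_1, …, A_d)`. -/
def cliffordSpectrum {d n : ℕ} (A : Fin d → Matrix (Fin n) (Fin n) ℂ) :
    Set (EuclideanSpace ℝ (Fin d)) :=
  {x | ¬ IsUnit (universalLocalizer A x)}

/-- A representation of the Clifford relations by `n × n` complex matrices. -/
structure IsCliffordRep {d n : ℕ} (γ : Fin d → Matrix (Fin n) (Fin n) ℂ) : Prop where
  isHermitian : ∀ j, (γ j).IsHermitian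
  mul_self : ∀ j, γ j * γ j = 1
  anticomm : ∀ j k, j ≠ k → γ j * γ k = -(γ k * γ j)

/-- An irreducible representation of the Clifford relations: the representation space `ℂ ^ n` is
nonzero and its only invariant subspaces are the trivial ones. -/
structure IsIrredCliffordRep {d n : ℕ} (γ : Fin d → Matrix (Fin n) (Fin n) ℂ) : Prop
    extends IsCliffordRep γ where
  pos : 0 < n
  irred : ∀ W : Submodule ℂ (Fin n → ℂ),
    (∀ j, ∀ v ∈ W, Matrix.mulVec (γ j) v ∈ W) → W = ⊥ ∨ W = ⊤

/-- The sign relation `γ_d = ε γ_{d-1} ⋯ γ_2 γ_1`, in which `γ_d` is the last entry of the tuple. -/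
def HasCliffordSign {d n : ℕ} (γ : Fin d → Matrix (Fin n) (Fin n) ℂ) (ε : ℂ) : Prop :=
  ∀ j : Fin d, (j : ℕ) + 1 = d → γ j = ε • ((List.ofFn γ).dropLast.reverse).prod

/-- The localizer `∑ j, (A_j - λ_j) ⊗ ρ_j` as a matrix, with the generators represented by `ρ`. -/
def localizer {d n r : ℕ} (ρ : Fin d → Matrix (Fin r) (Fin r) ℂ)
    (A : Fin d → Matrix (Fin n) (Fin n) ℂ) (x : EuclideanSpace ℝ (Fin d)) :
    Matrix (Fin n × Fin r) (Fin n × Fin r) ℂ :=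
  ∑ j, (A j - ((x j : ℝ) : ℂ) • (1 : Matrix (Fin n) (Fin n) ℂ)) ⊗ₖ ρ j

theorem localizer_isHermitian {d n r : ℕ} {ρ : Fin d → Matrix (Fin r) (Fin r) ℂ}
    {A : Fin d → Matrix (Fin n) (Fin n) ℂ} (hρ : ∀ j, (ρ j).IsHermitian)
    (hA : ∀ j, (A j).IsHermitian) (x : EuclideanSpace ℝ (Fin d)) :
    (localizer ρ A x).IsHermitian := by
  unfold localizer Matrix.IsHermitian
  rw [Matrix.conjTranspose_sum]
  refine Finset.sum_congr rfl fun j _ => ?_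
  rw [Matrix.conjTranspose_kronecker, Matrix.conjTranspose_sub, Matrix.conjTranspose_smul,
    Matrix.conjTranspose_one, (hρ j).eq, (hA j).eq]
  simp

/-- The signature of a Hermitian matrix: the number of positive eigenvalues minus the number of
negative eigenvalues, counted with multiplicity. -/
def signature {m : Type} [Fintype m] [DecidableEq m] (M : Matrix m m ℂ)
    (hM : M.IsHermitian) : ℤ :=
  (Finset.card {i | 0 < hM.eigenvalues i} : ℤ) - (Finset.card {i | hM.eigenvalues i < 0} : ℤ)

end CliffordSpec

end

/-! Put `g_j = γ_j ⊗ 1` and `e_j = 1 ⊗ ρ_j`. The products `T_j = g_j e_j` are commuting involutions,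
with joint spectral projections `P_s` for sign vectors `s`. A pair of reflections, one in each
factor, fixes `∑ T_j` and rotates the vector `x` (`exists_similar`), so only `x = r e_0` with `r =
±|x|` matters. There the localizer is `D + M` with `D = T_0` and `M = ∑_{j≥1} T_j - r e_0`. These
commute, and `M²` acts on `P_s` as `σ² + r²`, where `σ` is the sum of the signs after the first. The
eigenvalues are therefore `s_0 ± √(σ² + r²)`.

For odd `d` the number `σ` is even, so `(D + M)(M - D) = M² - 1` is invertible whenever `r² ≠ 1`.
This is pure algebra and holds over the universal Clifford algebra (`isUnit_pairLocalizer`).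

Multiplicities come from traces. A product of some of the `T_j` is traceless unless it is empty or
full, and the full product is the scalar `ε² = (-1)^m`, where `d = 2m + 1`; with `n² = 2^(2m)`
(`dim_sq`) this gives each `P_s` the trace `(1 + (-1)^m ∏ s_j) / 2`. In the signature, blocks with
`σ` and `-σ` cancel. What remains is `σ = 0`, `s_0 = 1`: `C(2m, m)` sign vectors, on which the
eigenvalues `1 ± r` have equal weight. At `r² = 1` the same blocks supply a kernel. -/

namespace CliffordSpec

/-! ### Joint spectral projections of commuting involutions -/

section JointProjections

variable {A : Type*} [Ring A] [Algebra ℂ A]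

/-- A commuting family of elements lifts to a commutative algebra. -/
theorem exists_commRing_lift {ι : Type*} (T : ι → A) (hcomm : ∀ i j, T i * T j = T j * T i) :
    ∃ (R : Subalgebra ℂ A) (_ : IsMulCommutative R) (t : ι → R), ∀ i, (t i : A) = T i := by
  refine ⟨Algebra.adjoin ℂ (Set.range T), Algebra.isMulCommutative_adjoin ℂ ?_,
    fun i => ⟨T i, Algebra.subset_adjoin ⟨i, rfl⟩⟩, fun i => rfl⟩
  rintro _ ⟨i, rfl⟩ _ ⟨j, rfl⟩
  exact hcomm i j

theorem int_unit_cast_mul_self (u : ℤˣ) : ((u : ℤ) : ℂ) * ((u : ℤ) : ℂ) = 1 := by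
  rcases Int.units_eq_one_or u with rfl | rfl <;> simp

/-- The joint spectral projections of a finite commuting family of involutions, together with the
products of subfamilies in terms of which they expand. -/
theorem exists_joint_projections {d : ℕ} (T : Fin d → A) (hsq : ∀ j, T j * T j = 1)
    (hcomm : ∀ i j, T i * T j = T j * T i) :
    ∃ (P : (Fin d → ℤˣ) → A) (Q : Finset (Fin d) → A),
      ∑ s, P s = 1 ∧
      (∀ s j, T j * P s = ((s j : ℤ) : ℂ) • P s) ∧
      (∀ s j, P s * T j = ((s j : ℤ) : ℂ) • P s) ∧
      (∀ s, P s = ((1 / 2 : ℂ) ^ d) • ∑ S, (∏ j ∈ S, ((s j : ℤ) : ℂ)) • Q S) ∧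
      Q ∅ = 1 ∧ Q Finset.univ = (List.ofFn T).prod ∧
      (∀ (u : A) (c : Fin d → ℂ), (∀ j, u * T j = c j • (T j * u)) →
        ∀ S, u * Q S = (∏ j ∈ S, c j) • (Q S * u)) := by
  -- In a commutative subalgebra the projections are the unordered products of `(1 + s_j t_j) / 2`,
  -- which expand over subsets.
  obtain ⟨R, hR, t, ht⟩ := exists_commRing_lift T hcomm
  let _ : CommRing R := { (inferInstance : Ring R) with mul_comm := hR.is_comm.comm }
  have tsq : ∀ j, t j * t j = 1 := fun j => Subtype.ext (by simp [ht, hsq])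
  let p : (Fin d → ℤˣ) → R := fun s => ∏ j, (1 / 2 : ℂ) • (1 + ((s j : ℤ) : ℂ) • t j)
  have hp : ∀ s j, t j * p s = ((s j : ℤ) : ℂ) • p s := by
    intro s j
    simp only [p]
    rw [← Finset.mul_prod_erase _ _ (Finset.mem_univ j), ← mul_assoc, ← smul_mul_assoc]
    congr 1
    rw [mul_smul_comm, smul_comm ((s j : ℤ) : ℂ)]
    congr 1
    rw [mul_add, mul_smul_comm, tsq, mul_one, smul_add, smul_smul, int_unit_cast_mul_self,
      one_smul, add_comm]
  refine ⟨fun s => (p s : A), fun S => ((∏ j ∈ S, t j : R) : A), ?_, ?_, ?_, ?_, ?_, ?_, ?_⟩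
  · have h1 : ∑ s, p s = 1 := by
      have := Finset.prod_univ_sum (fun _ : Fin d => (Finset.univ : Finset ℤˣ))
        (fun j u => (1 / 2 : ℂ) • (1 + ((u : ℤ) : ℂ) • t j))
      rw [Fintype.piFinset_univ] at this
      rw [← this]
      refine Finset.prod_eq_one fun j _ => ?_
      rw [UnitsInt.univ, Finset.sum_pair (by decide), ← smul_add]
      have : (1 + (((1 : ℤˣ) : ℤ) : ℂ) • t j) + (1 + (((-1 : ℤˣ) : ℤ) : ℂ) • t j) =
          (2 : ℂ) • (1 : R) := by
        rw [two_smul]; simp only [Units.val_one, Units.val_neg, Int.cast_one, Int.cast_neg, one_smul,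
          neg_smul]; abel
      rw [this, smul_smul]
      norm_num
    have := congrArg (fun r : R => (r : A)) h1
    simpa using this
  · intro s j
    have := congrArg (fun r : R => (r : A)) (hp s j)
    simpa [ht] using this
  · intro s j
    have := congrArg (fun r : R => (r : A)) ((mul_comm _ _).trans (hp s j))
    simpa [ht] using this
  · intro s
    have : p s = ((1 / 2 : ℂ) ^ d) • ∑ S, (∏ j ∈ S, ((s j : ℤ) : ℂ)) • ∏ j ∈ S, t j := by
      simp only [p]
      rw [← Finset.powerset_univ]
      simp only [← Finset.prod_smul]
      rw [← Finset.prod_one_add, Finset.prod_smul]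
      simp
    have := congrArg (fun r : R => (r : A)) this
    simpa using this
  · simp
  · change ((∏ j, t j : R) : A) = _
    rw [← List.prod_ofFn, ← R.val_apply, map_list_prod, List.map_ofFn]
    congr 2
    funext j
    exact ht j
  · intro u c hu S
    induction S using Finset.induction_on with
    | empty => simp
    | insert a S ha ih =>
      simp only at ih ⊢
      rw [Finset.prod_insert ha, Finset.prod_insert ha, Subalgebra.coe_mul, ht, ← mul_assoc, hu,
        smul_mul_assoc, mul_assoc, ih, mul_smul_comm, smul_smul, mul_assoc]

end JointProjections

/-! ### Pairs of Clifford families and the products `g_j e_j` -/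

/-- Two commuting families of anticommuting involutions in a ring. -/
structure IsCliffordPair {A : Type*} [Ring A] {d : ℕ} (g e : Fin d → A) : Prop where
  g_sq : ∀ j, g j * g j = 1
  e_sq : ∀ j, e j * e j = 1
  g_anti : ∀ i j, i ≠ j → g i * g j = -(g j * g i)
  e_anti : ∀ i j, i ≠ j → e i * e j = -(e j * e i)
  comm : ∀ i j, g i * e j = e j * g i

namespace IsCliffordPair

section Products

variable {A : Type*} [Ring A] {d : ℕ} {g e : Fin d → A}

theorem symm (h : IsCliffordPair g e) : IsCliffordPair e g :=
  ⟨h.e_sq, h.g_sq, h.e_anti, h.g_anti, fun i j => (h.comm j i).symm⟩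

theorem prod_sq (h : IsCliffordPair g e) (j : Fin d) : (g j * e j) * (g j * e j) = 1 := by
  rw [mul_assoc, ← mul_assoc (e j), ← h.comm j j, mul_assoc, h.e_sq, mul_one, h.g_sq]

theorem g_mul_prod_self (h : IsCliffordPair g e) (j : Fin d) :
    g j * (g j * e j) = (g j * e j) * g j := by
  rw [mul_assoc (g j), ← h.comm j j]

theorem e_mul_prod_self (h : IsCliffordPair g e) (j : Fin d) :
    e j * (g j * e j) = (g j * e j) * e j := by
  rw [← mul_assoc, ← h.comm j j]

theorem g_mul_prod (h : IsCliffordPair g e) {i j : Fin d} (hij : i ≠ j) :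
    g i * (g j * e j) = -((g j * e j) * g i) := by
  rw [← mul_assoc, h.g_anti i j hij, mul_assoc (g j), ← h.comm i j, ← mul_assoc, neg_mul]

theorem e_mul_prod (h : IsCliffordPair g e) {i j : Fin d} (hij : i ≠ j) :
    e i * (g j * e j) = -((g j * e j) * e i) := by
  rw [← mul_assoc, ← h.comm j i, mul_assoc, h.e_anti i j hij, mul_assoc (g j), mul_neg]

theorem prod_comm (h : IsCliffordPair g e) (i j : Fin d) :
    (g i * e i) * (g j * e j) = (g j * e j) * (g i * e i) := by
  rcases eq_or_ne i j with rfl | hij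
  · rfl
  · rw [mul_assoc, h.e_mul_prod hij, mul_neg, ← mul_assoc, h.g_mul_prod hij, neg_mul, neg_neg,
      mul_assoc]

theorem list_prod (h : IsCliffordPair g e) (l : List (Fin d)) :
    (l.map fun j => g j * e j).prod = (l.map g).prod * (l.map e).prod := by
  induction l with
  | nil => simp
  | cons a l ih =>
    have hc : Commute (e a) (l.map g).prod := by
      refine Commute.list_prod_right _ _ fun x hx => ?_
      obtain ⟨i, -, rfl⟩ := List.mem_map.1 hx
      exact (h.comm i a).symm
    simp only [List.map_cons, List.prod_cons]
    rw [ih, mul_assoc, ← mul_assoc (e a), hc.eq, mul_assoc, mul_assoc]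

theorem ofFn_prod (h : IsCliffordPair g e) :
    (List.ofFn fun j => g j * e j).prod = (List.ofFn g).prod * (List.ofFn e).prod := by
  simpa [List.ofFn_eq_map] using h.list_prod (List.finRange d)

end Products

/-! ### Traces of the joint projections -/

section Trace

variable {A : Type*} [Ring A] [Algebra ℂ A] {d : ℕ} {g e : Fin d → A}

/-- This is the sign from moving `g i` past the product over `S`: one factor `-1` for each `j ≠ i`
in `S`. The count is odd for `i ∈ S` when `S` has even size, and for `i ∉ S` when it has odd size.
-/
theorem prod_ite_eq_neg_one {d : ℕ} {S : Finset (Fin d)} (h0 : S ≠ ∅)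
    (h1 : S ≠ Finset.univ) :
    ∃ i, ∏ j ∈ S, (if i = j then (1 : ℂ) else -1) = -1 := by
  have key : ∀ i, ∏ j ∈ S, (if i = j then (1 : ℂ) else -1) = (-1) ^ (S.erase i).card := by
    intro i
    rw [Finset.prod_ite, Finset.prod_const_one, one_mul, Finset.prod_const]
    congr 2
    ext j
    simp [and_comm, eq_comm]
  rcases Nat.even_or_odd S.card with hS | hS
  · obtain ⟨i, hi⟩ := Finset.nonempty_iff_ne_empty.2 h0
    refine ⟨i, ?_⟩
    rw [key, Finset.card_erase_of_mem hi]
    refine Odd.neg_one_pow (Nat.Even.sub_odd ?_ hS odd_one)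
    exact Finset.card_pos.2 ⟨i, hi⟩
  · obtain ⟨i, hi⟩ : ∃ i, i ∉ S := by
      by_contra! hc
      exact h1 (Finset.eq_univ_iff_forall.2 hc)
    refine ⟨i, ?_⟩
    rw [key, Finset.erase_eq_of_notMem hi]
    exact hS.neg_one_pow

/-- The traces of the joint spectral projections of the products `g j * e j`. -/
theorem trace_projection (h : IsCliffordPair g e) (hd : 0 < d) {κ : ℂ}
    (hκ : (List.ofFn fun j => g j * e j).prod = κ • 1) (τ : A →ₗ[ℂ] ℂ)
    (hτ : ∀ a b, τ (a * b) = τ (b * a)) {P : (Fin d → ℤˣ) → A} {Q : Finset (Fin d) → A}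
    (hP : ∀ s, P s = ((1 / 2 : ℂ) ^ d) • ∑ S, (∏ j ∈ S, ((s j : ℤ) : ℂ)) • Q S)
    (hQ0 : Q ∅ = 1) (hQ1 : Q Finset.univ = (List.ofFn fun j => g j * e j).prod)
    (hQ : ∀ (u : A) (c : Fin d → ℂ), (∀ j, u * (g j * e j) = c j • ((g j * e j) * u)) →
        ∀ S, u * Q S = (∏ j ∈ S, c j) • (Q S * u)) (s : Fin d → ℤˣ) :
    τ (P s) = (1 / 2 : ℂ) ^ d * (1 + κ * ∏ j, ((s j : ℤ) : ℂ)) * τ 1 := by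
  -- Conjugation by a suitable involution `g i` preserves the trace and negates `Q S`.
  have hzero : ∀ S : Finset (Fin d), S ≠ ∅ ∧ S ≠ Finset.univ → τ (Q S) = 0 := by
    rintro S ⟨h0, h1⟩
    obtain ⟨i, hi⟩ := prod_ite_eq_neg_one h0 h1
    have := hQ (g i) (fun j => if i = j then 1 else -1) (fun j => by
      split_ifs with hij
      · subst hij; rw [one_smul, h.g_mul_prod_self]
      · rw [h.g_mul_prod hij, neg_one_smul]) S
    rw [hi, neg_one_smul] at this
    have h2 : τ (Q S) = -τ (Q S) := by
      calc τ (Q S) = τ (g i * (g i * Q S)) := by rw [← mul_assoc, h.g_sq, one_mul]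
        _ = -τ (g i * (Q S * g i)) := by rw [this, mul_neg, map_neg]
        _ = -τ (Q S) := by rw [hτ, mul_assoc, h.g_sq, mul_one]
    have h3 : (2 : ℂ) * τ (Q S) = 0 := by linear_combination h2
    simpa using h3
  have hne : (∅ : Finset (Fin d)) ≠ Finset.univ := by
    have : Nonempty (Fin d) := ⟨⟨0, hd⟩⟩
    exact Finset.univ_nonempty.ne_empty.symm
  rw [hP, map_smul, map_sum, Finset.sum_eq_add ∅ Finset.univ hne
    (fun S _ hS => by rw [map_smul, hzero S hS, smul_zero]) (by simp) (by simp), hQ0, hQ1, hκ]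
  simp only [map_smul, smul_eq_mul, Finset.prod_empty]
  ring

end Trace

end IsCliffordPair

/-! ### Rotating the localizer to a coordinate axis -/

/-- The element `∑ j, x_j e_j`. -/
noncomputable def cliffordVec {A : Type*} [Ring A] [Algebra ℂ A] {d : ℕ} (e : Fin d → A)
    (x : Fin d → ℝ) : A :=
  ∑ j, ((x j : ℝ) : ℂ) • e j

/-- The element `∑ j, (g_j - x_j) e_j`, the localizer of `g` formed with `e`. -/
noncomputable def pairLocalizer {A : Type*} [Ring A] [Algebra ℂ A] {d : ℕ} (g e : Fin d → A)
    (x : Fin d → ℝ) : A :=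
  ∑ j, g j * e j - cliffordVec e x

theorem sum_smul_mul_self {A : Type*} [Ring A] [Algebra ℂ A] {d : ℕ} {e : Fin d → A}
    (hsq : ∀ j, e j * e j = 1) (hanti : ∀ i j, i ≠ j → e i * e j = -(e j * e i))
    (c : Fin d → ℂ) : (∑ j, c j • e j) * (∑ j, c j • e j) = (∑ j, c j ^ 2) • 1 := by
  have hpair : ∀ i j, e i * e j + e j * e i = if i = j then (2 : ℂ) • 1 else 0 := by
    intro i j
    split_ifs with hij
    · subst hij; rw [hsq, two_smul]
    · rw [hanti i j hij, neg_add_cancel]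
  set v := ∑ j, c j • e j with hv
  have h1 : v * v = ∑ i, ∑ j, (c i * c j) • (e i * e j) := by
    simp only [hv, Finset.sum_mul_sum, smul_mul_smul_comm]
  have h2 : v * v = ∑ i, ∑ j, (c i * c j) • (e j * e i) := by
    rw [h1, Finset.sum_comm]
    simp only [mul_comm]
  have h3 : (2 : ℂ) • (v * v) = (2 : ℂ) • ((∑ j, c j ^ 2) • (1 : A)) := by
    rw [two_smul]
    nth_rewrite 1 [h1]
    rw [h2, ← Finset.sum_add_distrib]
    simp only [← Finset.sum_add_distrib, ← smul_add, hpair]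
    simp only [smul_ite, smul_zero, Finset.sum_ite_eq, Finset.mem_univ, if_true, smul_smul]
    rw [← Finset.sum_smul]
    congr 1
    rw [Finset.mul_sum]
    exact Finset.sum_congr rfl fun i _ => by ring
  exact smul_right_injective A (two_ne_zero' ℂ) h3

namespace IsCliffordPair

section Rotation

variable {A : Type*} [Ring A] [Algebra ℂ A] {d : ℕ} {g e : Fin d → A}

theorem vec_sq (h : IsCliffordPair g e) (x : Fin d → ℝ) :
    cliffordVec e x * cliffordVec e x = ((∑ j, x j ^ 2 : ℝ) : ℂ) • 1 := by
  rw [cliffordVec, sum_smul_mul_self h.e_sq h.e_anti]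
  push_cast
  rfl

theorem e_mul_sum (h : IsCliffordPair g e) (i : Fin d) :
    e i * ∑ j, g j * e j = (2 : ℂ) • g i - (∑ j, g j * e j) * e i := by
  rw [eq_sub_iff_add_eq, Finset.mul_sum, Finset.sum_mul, ← Finset.sum_add_distrib,
    Finset.sum_eq_single i]
  · rw [h.e_mul_prod_self, mul_assoc, h.e_sq, mul_one, two_smul]
  · intro j _ hj
    rw [h.e_mul_prod hj.symm, neg_add_cancel]
  · simp

theorem vec_mul_sum (h : IsCliffordPair g e) (x : Fin d → ℝ) :
    cliffordVec e x * ∑ j, g j * e j =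
      (2 : ℂ) • cliffordVec g x - (∑ j, g j * e j) * cliffordVec e x := by
  rw [cliffordVec, Finset.sum_mul, cliffordVec, Finset.smul_sum, Finset.mul_sum (s := Finset.univ)
    (f := fun j => ((x j : ℝ) : ℂ) • e j), ← Finset.sum_sub_distrib]
  refine Finset.sum_congr rfl fun i _ => ?_
  rw [smul_mul_assoc, h.e_mul_sum, smul_sub, smul_comm, mul_smul_comm]

theorem vec_comm (h : IsCliffordPair g e) (x y : Fin d → ℝ) :
    cliffordVec g x * cliffordVec e y = cliffordVec e y * cliffordVec g x := by
  have : Commute (cliffordVec g x) (cliffordVec e y) := by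
    unfold cliffordVec
    exact Commute.sum_left _ _ _ fun i _ => Commute.sum_right _ _ _ fun j _ =>
      (Commute.smul_right (h.comm i j) _).smul_left _
  exact this.eq

/-- Each vector anticommutes with the sum up to twice its counterpart in the other family. The two
errors are `2 g(y)²` and `2 e(y)²`, both `2|y|²`, and cancel. -/
theorem vec_mul_vec_mul_sum (h : IsCliffordPair g e) (y : Fin d → ℝ) :
    (cliffordVec g y * cliffordVec e y) * ∑ j, g j * e j =
      (∑ j, g j * e j) * (cliffordVec g y * cliffordVec e y) := by
  have hsum : ∑ j, e j * g j = ∑ j, g j * e j :=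
    Finset.sum_congr rfl fun j _ => (h.comm j j).symm
  have h2 := h.symm.vec_mul_sum y
  rw [hsum] at h2
  rw [mul_assoc, h.vec_mul_sum, mul_sub, ← mul_assoc (cliffordVec g y), h2, sub_mul,
    mul_smul_comm, smul_mul_assoc, h.vec_sq, h.symm.vec_sq, mul_assoc, sub_sub_cancel]

/-- The localizer at `x` is similar to the localizer at a multiple of a basis vector. -/
theorem exists_similar (h : IsCliffordPair g e) (i : Fin d) (x : Fin d → ℝ) :
    ∃ r : ℝ, r ^ 2 = ∑ j, x j ^ 2 ∧ ∃ W : Aˣ,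
      (W : A) * pairLocalizer g e x = (∑ j, g j * e j - (r : ℂ) • e i) * W := by
  have hnn : 0 ≤ ∑ j, x j ^ 2 := Finset.sum_nonneg fun j _ => sq_nonneg _
  set r := Real.sqrt (∑ j, x j ^ 2) with hr
  have hr2 : r ^ 2 = ∑ j, x j ^ 2 := Real.sq_sqrt hnn
  have hsingle : ∀ f : Fin d → A, cliffordVec f (Pi.single i r) = (r : ℂ) • f i := by
    intro f
    rw [cliffordVec, Finset.sum_eq_single i]
    · simp
    · intro j _ hj; simp [hj]
    · simp
  have hadd : ∀ (f : Fin d → A) (u v : Fin d → ℝ),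
      cliffordVec f (u + v) = cliffordVec f u + cliffordVec f v := by
    intro f u v
    simp [cliffordVec, add_smul, Finset.sum_add_distrib]
  -- The conjugator is built from the bisector of `x` and `r e_i`. If that vanishes, `x` is already
  -- on the axis, with coordinate `-r`.
  by_cases hy : x + Pi.single i r = 0
  · refine ⟨-r, by rw [neg_sq, hr2], 1, ?_⟩
    have : cliffordVec e x = ((-r : ℝ) : ℂ) • e i := by
      have h0 := hadd e x (Pi.single i r)
      rw [hy, hsingle] at h0
      have hz : cliffordVec e (0 : Fin d → ℝ) = 0 := by simp [cliffordVec]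
      rw [hz] at h0
      rw [Complex.ofReal_neg, neg_smul]
      exact eq_neg_of_add_eq_zero_left h0.symm
    rw [pairLocalizer, this]
    simp
  · refine ⟨r, hr2, ?_⟩
    set y := x + Pi.single i r with hy'
    have hpos : (((∑ j, y j ^ 2 : ℝ)) : ℂ) ≠ 0 := by
      obtain ⟨j, hj⟩ := Function.ne_iff.1 hy
      have : 0 < ∑ j, y j ^ 2 :=
        Finset.sum_pos' (fun j _ => sq_nonneg _) ⟨j, Finset.mem_univ _, by
          have : y j ≠ 0 := hj
          positivity⟩
      exact_mod_cast this.ne'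
    have hu : ∀ a : A, a * a = (((∑ j, y j ^ 2 : ℝ)) : ℂ) • 1 → IsUnit a := by
      intro a ha
      have : IsUnit (a * a) := by
        rw [ha, ← Algebra.algebraMap_eq_smul_one]
        exact (isUnit_iff_ne_zero.2 hpos).map _
      exact ((Commute.refl a).isUnit_mul_iff.1 this).1
    obtain ⟨W, hW⟩ := (hu _ (h.symm.vec_sq y)).mul (hu _ (h.vec_sq y))
    refine ⟨W, ?_⟩
    -- Both sides equal `r² + r e_i e(x)`, because `e(x)² = r²`.
    have hYx : cliffordVec e y * cliffordVec e x = ((r : ℂ) • e i) * cliffordVec e y := by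
      rw [hadd, hsingle, add_mul, mul_add, h.vec_sq, smul_mul_smul_comm, h.e_sq, ← hr2, add_comm]
      congr 2
      push_cast
      ring
    have hge : Commute (cliffordVec g y) ((r : ℂ) • e i) := by
      rw [← hsingle]; exact h.vec_comm _ _
    rw [hW, pairLocalizer, mul_sub, sub_mul, h.vec_mul_vec_mul_sum,
      mul_assoc (cliffordVec g y), hYx, ← mul_assoc (cliffordVec g y), hge.eq,
      mul_assoc ((r : ℂ) • e i)]

end Rotation

/-! ### Invertibility off the sphere -/

section Tail

variable {A : Type*} [Ring A] [Algebra ℂ A] {k : ℕ} {g e : Fin (k + 1) → A}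

/-- The sum of all but the first sign. -/
def tailSum {k : ℕ} (s : Fin (k + 1) → ℤˣ) : ℤ := ∑ j : Fin k, (s j.succ : ℤ)

theorem even_tailSum (hk : Even k) (s : Fin (k + 1) → ℤˣ) : Even (tailSum s) := by
  have h2 : (2 : ℤ) ∣ ∑ j : Fin k, ((s j.succ : ℤ) - 1) := Finset.dvd_sum fun j _ => by
    rcases Int.units_eq_one_or (s j.succ) with h | h <;> rw [h] <;> decide
  rw [Finset.sum_sub_distrib, Finset.sum_const, Finset.card_univ, Fintype.card_fin, nsmul_eq_mul,
    mul_one] at h2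
  have h3 : Even ((k : ℕ) : ℤ) := by exact_mod_cast hk
  simpa [tailSum] using (even_iff_two_dvd.2 h2).add h3

theorem four_le_sq_of_even {σ : ℤ} (h : Even σ) (h0 : σ ≠ 0) : 4 ≤ (σ : ℝ) ^ 2 := by
  obtain ⟨a, rfl⟩ := h
  have ha0 : a ≠ 0 := by rintro rfl; simp at h0
  have h1 : (1 : ℤ) ≤ a ^ 2 := by
    have := Int.one_le_abs ha0
    nlinarith [sq_abs a]
  have h4 : (4 : ℤ) ≤ (a + a) ^ 2 := by nlinarith
  exact_mod_cast h4

/-- The summand of the localizer at `r e_0` complementary to `g_0 e_0`. -/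
noncomputable def tailPart (g e : Fin (k + 1) → A) (r : ℝ) : A :=
  ∑ j : Fin k, g j.succ * e j.succ - (r : ℂ) • e 0

theorem sum_sub_eq (g e : Fin (k + 1) → A) (r : ℝ) :
    ∑ j, g j * e j - (r : ℂ) • e 0 = g 0 * e 0 + tailPart g e r := by
  rw [tailPart, Fin.sum_univ_succ, add_sub_assoc]

theorem commute_tailPart (h : IsCliffordPair g e) (r : ℝ) :
    Commute (g 0 * e 0) (tailPart g e r) := by
  refine Commute.sub_right (Commute.sum_right _ _ _ fun j _ => h.prod_comm _ _)
    (Commute.smul_right ?_ _)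
  exact (h.e_mul_prod_self 0).symm

/-- `e 0` anticommutes with every later product, so the cross terms cancel. Thus the square is
diagonal in the joint projections although `tailPart` itself need not be. -/
theorem tailPart_sq (h : IsCliffordPair g e) (r : ℝ) :
    tailPart g e r * tailPart g e r =
      (∑ j : Fin k, g j.succ * e j.succ) * (∑ j : Fin k, g j.succ * e j.succ) +
        ((r ^ 2 : ℝ) : ℂ) • 1 := by
  have : e 0 * ∑ j : Fin k, g j.succ * e j.succ = -((∑ j : Fin k, g j.succ * e j.succ) * e 0) := by
    rw [Finset.mul_sum, Finset.sum_mul, ← Finset.sum_neg_distrib]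
    exact Finset.sum_congr rfl fun j _ => h.e_mul_prod (Fin.succ_ne_zero j).symm
  rw [tailPart, sub_mul, mul_sub, mul_sub, smul_mul_assoc, this, mul_smul_comm, smul_mul_smul_comm,
    h.e_sq]
  push_cast
  rw [pow_two]
  simp only [smul_neg]
  abel

variable {P : (Fin (k + 1) → ℤˣ) → A}

theorem tailSum_mul (hP : ∀ s j, (g j * e j) * P s = ((s j : ℤ) : ℂ) • P s)
    (s : Fin (k + 1) → ℤˣ) :
    (∑ j : Fin k, g j.succ * e j.succ) * P s = (tailSum s : ℂ) • P s := by
  rw [Finset.sum_mul, tailSum]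
  push_cast
  rw [Finset.sum_smul]
  exact Finset.sum_congr rfl fun j _ => hP s _

theorem tailPart_sq_mul (h : IsCliffordPair g e)
    (hP : ∀ s j, (g j * e j) * P s = ((s j : ℤ) : ℂ) • P s) (r : ℝ) (s : Fin (k + 1) → ℤˣ) :
    tailPart g e r * (tailPart g e r * P s) = (((tailSum s : ℝ) ^ 2 + r ^ 2 : ℝ) : ℂ) • P s := by
  rw [← mul_assoc, h.tailPart_sq, add_mul, mul_assoc, tailSum_mul hP, mul_smul_comm,
    tailSum_mul hP, smul_smul, smul_mul_assoc, one_mul, ← add_smul]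
  congr 1
  push_cast
  ring

/-- The localizer is invertible away from the unit sphere. -/
theorem isUnit_pairLocalizer (h : IsCliffordPair g e) (hk : Even k) (x : Fin (k + 1) → ℝ)
    (hx : ∑ j, x j ^ 2 ≠ 1) : IsUnit (pairLocalizer g e x) := by
  obtain ⟨r, hr, W, hW⟩ := h.exists_similar 0 x
  obtain ⟨P, Q, hsum, hP, hP', -⟩ := exists_joint_projections _ h.prod_sq h.prod_comm
  set M := tailPart g e r with hM
  set D := g 0 * e 0 with hD
  have hcomm : Commute D M := h.commute_tailPart r
  have hr1 : r ^ 2 ≠ 1 := by rwa [hr]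
  -- Parity is essential: a tail sum `±1` would make this vanish at `r = 0`.
  have hne : ∀ s : Fin (k + 1) → ℤˣ, (((tailSum s : ℝ) ^ 2 + r ^ 2 - 1 : ℝ) : ℂ) ≠ 0 := by
    intro s
    rw [Complex.ofReal_ne_zero]
    rcases eq_or_ne (tailSum s) 0 with h0 | h0
    · rw [h0]
      simpa using sub_ne_zero.2 hr1
    · have := four_le_sq_of_even (even_tailSum hk s) h0
      exact ne_of_gt (by linarith [sq_nonneg r])
  have hMP : ∀ s, (M * M - 1) * P s = (((tailSum s : ℝ) ^ 2 + r ^ 2 - 1 : ℝ) : ℂ) • P s := by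
    intro s
    rw [sub_mul, mul_assoc, h.tailPart_sq_mul hP, one_mul, Complex.ofReal_sub, sub_smul,
      Complex.ofReal_one, one_smul]
  set K : A := ∑ s, ((((tailSum s : ℝ) ^ 2 + r ^ 2 - 1 : ℝ) : ℂ)⁻¹) • P s with hK
  have hright : (M * M - 1) * K = 1 := by
    rw [hK, Finset.mul_sum]
    refine (Finset.sum_congr rfl fun s _ => by
      rw [mul_smul_comm, hMP, smul_smul, inv_mul_cancel₀ (hne s), one_smul]).trans hsum
  have hPS : ∀ s, Commute (P s) (∑ j : Fin k, g j.succ * e j.succ) := fun s =>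
    Commute.sum_right _ _ _ fun j _ => by
      rw [commute_iff_eq, hP, hP']
  have hPM : ∀ s, Commute (P s) (M * M - 1) := by
    intro s
    rw [hM, h.tailPart_sq]
    exact (((hPS s).mul_right (hPS s)).add_right ((Commute.one_right _).smul_right _)).sub_right
      (Commute.one_right _)
  have hleft : K * (M * M - 1) = 1 := by
    refine Eq.trans ?_ hright
    exact (Commute.sum_left _ _ _ fun s _ => (hPM s).smul_left _).eq
  have hunit : IsUnit (M * M - 1) := ⟨⟨_, K, hright, hleft⟩, rfl⟩
  have hD2 : D * D = 1 := h.prod_sq 0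
  -- As `D² = 1`, the localizer `D + M` is a commuting factor of the unit `M² - 1`.
  have hL : IsUnit (D + M) := by
    have h1 : (D + M) * (M - D) = M * M - 1 := by
      rw [add_mul, mul_sub, mul_sub, hD2, hcomm.eq]
      abel
    have h2 : Commute (D + M) (M - D) :=
      (hcomm.sub_right (Commute.refl D)).add_left ((Commute.refl M).sub_right hcomm.symm)
    rw [← h1] at hunit
    exact (h2.isUnit_mul_iff.1 hunit).1
  rw [sum_sub_eq] at hW
  have : pairLocalizer g e x = ↑W⁻¹ * (D + M) * W := by
    rw [mul_assoc, ← hW, Units.inv_mul_cancel_left]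
  rw [this]
  exact (W⁻¹.isUnit.mul hL).mul W.isUnit

end Tail

end IsCliffordPair

/-! ### Traces of polynomials in the localizer -/

theorem aeval_mul_of_mul_eq {A : Type*} [Ring A] [Algebra ℂ A] {w a b : A} (h : w * a = b * w)
    (p : Polynomial ℂ) : w * Polynomial.aeval a p = Polynomial.aeval b p * w := by
  induction p using Polynomial.induction_on with
  | C c => simp [Algebra.commutes]
  | add p q hp hq => rw [map_add, map_add, mul_add, add_mul, hp, hq]
  | monomial n c ih =>
    rw [pow_succ, ← mul_assoc, map_mul, Polynomial.aeval_X, map_mul _ _ Polynomial.X,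
      Polynomial.aeval_X, ← mul_assoc, ih, mul_assoc, h, mul_assoc]

/-- The weighted average of `f` over the two eigenvalues `u ± √(σ² + q)` of a two-dimensional block. -/
noncomputable def blockValue {E : Type*} [AddCommGroup E] [Module ℝ E] (f : ℝ → E) (q : ℝ)
    (u : ℤˣ) (σ : ℤ) : E :=
  ((1 + σ / √((σ : ℝ) ^ 2 + q)) / 2) • f ((u : ℤ) + √((σ : ℝ) ^ 2 + q)) +
    ((1 - σ / √((σ : ℝ) ^ 2 + q)) / 2) • f ((u : ℤ) - √((σ : ℝ) ^ 2 + q))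

namespace IsCliffordPair

variable {A : Type*} [Ring A] [Algebra ℂ A] {k : ℕ} {g e : Fin (k + 1) → A}
  {P : (Fin (k + 1) → ℤˣ) → A}

theorem add_tailPart_mul (hP : ∀ s j, (g j * e j) * P s = ((s j : ℤ) : ℂ) • P s) (r : ℝ)
    (s : Fin (k + 1) → ℤˣ) :
    (g 0 * e 0 + tailPart g e r) * P s = ((s 0 : ℤ) : ℂ) • P s + tailPart g e r * P s := by
  rw [add_mul, hP]

theorem add_tailPart_mul_tailPart_mul (h : IsCliffordPair g e)
    (hP : ∀ s j, (g j * e j) * P s = ((s j : ℤ) : ℂ) • P s) (r : ℝ) (s : Fin (k + 1) → ℤˣ) :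
    (g 0 * e 0 + tailPart g e r) * (tailPart g e r * P s) =
      ((s 0 : ℤ) : ℂ) • (tailPart g e r * P s) +
        (((tailSum s : ℝ) ^ 2 + r ^ 2 : ℝ) : ℂ) • P s := by
  rw [add_mul, h.tailPart_sq_mul hP, ← mul_assoc, (h.commute_tailPart r).eq, mul_assoc, hP,
    mul_smul_comm]

/-- Left multiplication by `D + M` preserves the span of `P s` and `M P s`, with eigenvalues `s_0 ±
μ`; the right side is linear interpolation of `p` at these two points. -/
theorem aeval_mul_projection (h : IsCliffordPair g e)
    (hP : ∀ s j, (g j * e j) * P s = ((s j : ℤ) : ℂ) • P s) (r : ℝ) (s : Fin (k + 1) → ℤˣ)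
    {μ : ℂ} (hμ : μ ^ 2 = (((tailSum s : ℝ) ^ 2 + r ^ 2 : ℝ) : ℂ)) (hμ0 : μ ≠ 0)
    (p : Polynomial ℂ) :
    Polynomial.aeval (g 0 * e 0 + tailPart g e r) p * P s =
      ((p.eval (((s 0 : ℤ) : ℂ) + μ) + p.eval (((s 0 : ℤ) : ℂ) - μ)) / 2) • P s +
      ((p.eval (((s 0 : ℤ) : ℂ) + μ) - p.eval (((s 0 : ℤ) : ℂ) - μ)) / (2 * μ)) •
        (tailPart g e r * P s) := by
  induction p using Polynomial.induction_on with
  | C c => simp [Algebra.algebraMap_eq_smul_one]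
  | add p q hp hq =>
    rw [map_add, add_mul, hp, hq]
    simp only [Polynomial.eval_add]
    module
  | monomial n c ih =>
    have hX : Polynomial.C c * Polynomial.X ^ (n + 1) =
        Polynomial.X * (Polynomial.C c * Polynomial.X ^ n) := by ring
    rw [hX, map_mul, Polynomial.aeval_X, mul_assoc, ih, mul_add, mul_smul_comm, mul_smul_comm,
      add_tailPart_mul hP, h.add_tailPart_mul_tailPart_mul hP, ← hμ]
    rw [Polynomial.eval_mul (p := Polynomial.X), Polynomial.eval_mul (p := Polynomial.X),
      Polynomial.eval_X, Polynomial.eval_X]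
    match_scalars <;> field_simp <;> ring

theorem aeval_mul_projection_of_eq_zero
    (hP : ∀ s j, (g j * e j) * P s = ((s j : ℤ) : ℂ) • P s) (s : Fin (k + 1) → ℤˣ)
    (hσ : tailSum s = 0) (p : Polynomial ℂ) :
    Polynomial.aeval (g 0 * e 0 + tailPart g e 0) p * P s =
      p.eval ((s 0 : ℤ) : ℂ) • P s := by
  have h1 : (g 0 * e 0 + tailPart g e 0) * P s = ((s 0 : ℤ) : ℂ) • P s := by
    rw [add_tailPart_mul hP, tailPart, sub_mul, tailSum_mul hP, hσ]
    simp
  induction p using Polynomial.induction_on with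
  | C c => simp [Algebra.algebraMap_eq_smul_one]
  | add p q hp hq => rw [map_add, add_mul, hp, hq, Polynomial.eval_add, add_smul]
  | monomial n c ih =>
    have hX : Polynomial.C c * Polynomial.X ^ (n + 1) =
        Polynomial.X * (Polynomial.C c * Polynomial.X ^ n) := by ring
    rw [hX, map_mul, Polynomial.aeval_X, mul_assoc, ih, mul_smul_comm, h1, smul_smul,
      Polynomial.eval_mul (p := Polynomial.X), Polynomial.eval_X, mul_comm]

/-- The trace of a polynomial in the localizer at `r e_0`, on a joint spectral projection. -/
theorem trace_aeval_mul_projection (h : IsCliffordPair g e) (hk : 0 < k) (τ : A →ₗ[ℂ] ℂ)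
    (hτ : ∀ a b, τ (a * b) = τ (b * a))
    (hP : ∀ s j, (g j * e j) * P s = ((s j : ℤ) : ℂ) • P s)
    (hP' : ∀ s j, P s * (g j * e j) = ((s j : ℤ) : ℂ) • P s) (r : ℝ) (s : Fin (k + 1) → ℤˣ)
    (p : Polynomial ℂ) :
    τ (Polynomial.aeval (g 0 * e 0 + tailPart g e r) p * P s) =
      τ (P s) * blockValue (fun y : ℝ => p.eval (y : ℂ)) (r ^ 2) (s 0) (tailSum s) := by
  -- Conjugation by `g j * e j` with `j ≠ 0` fixes `P s` and negates `e 0`; such a `j` exists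
  -- because `0 < k`.
  have he : τ (e 0 * P s) = 0 := by
    set j : Fin (k + 1) := Fin.succ ⟨0, hk⟩ with hj
    have h0j : (0 : Fin (k + 1)) ≠ j := (Fin.succ_ne_zero _).symm
    have h2 : τ (e 0 * P s) = -τ (e 0 * P s) := by
      calc τ (e 0 * P s) = τ (e 0 * ((g j * e j) * (P s * (g j * e j)))) := by
            rw [hP', mul_smul_comm, hP, smul_smul, int_unit_cast_mul_self, one_smul]
        _ = τ ((e 0 * (g j * e j) * P s) * (g j * e j)) := by simp only [mul_assoc]
        _ = τ ((g j * e j) * (e 0 * (g j * e j) * P s)) := hτ _ _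
        _ = -τ (e 0 * P s) := by
            rw [h.e_mul_prod h0j, neg_mul, mul_neg, map_neg, mul_assoc (g j * e j) (e 0),
              ← mul_assoc (g j * e j) (g j * e j), h.prod_sq, one_mul]
    have h3 : (2 : ℂ) * τ (e 0 * P s) = 0 := by linear_combination h2
    simpa using h3
  have hM : τ (tailPart g e r * P s) = (tailSum s : ℂ) * τ (P s) := by
    rw [tailPart, sub_mul, tailSum_mul hP, smul_mul_assoc, map_sub, map_smul, map_smul, he,
      smul_zero, sub_zero, smul_eq_mul]
  have hnn : 0 ≤ (tailSum s : ℝ) ^ 2 + r ^ 2 := by positivity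
  rcases eq_or_ne ((tailSum s : ℝ) ^ 2 + r ^ 2) 0 with hz | hz
  · have hr : r = 0 := by nlinarith [sq_nonneg (tailSum s : ℝ), sq_nonneg r]
    have hσ : tailSum s = 0 := by
      have : (tailSum s : ℝ) = 0 := by nlinarith [sq_nonneg (tailSum s : ℝ), sq_nonneg r]
      exact_mod_cast this
    subst hr
    rw [aeval_mul_projection_of_eq_zero hP s hσ, hσ]
    -- Here `σ / √(σ² + r²)` is `0 / 0 = 0`, so both weights are `1/2` and both nodes are `s 0`.
    simp only [blockValue, map_smul, smul_eq_mul, Complex.real_smul]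
    simp
    ring
  · set μ := √((tailSum s : ℝ) ^ 2 + r ^ 2) with hμ
    have hμ2 : ((μ : ℝ) : ℂ) ^ 2 = (((tailSum s : ℝ) ^ 2 + r ^ 2 : ℝ) : ℂ) := by
      rw [← Complex.ofReal_pow, Real.sq_sqrt hnn]
    have hμ0 : ((μ : ℝ) : ℂ) ≠ 0 := by
      rw [Complex.ofReal_ne_zero, hμ, Real.sqrt_ne_zero hnn]
      exact hz
    rw [h.aeval_mul_projection hP r s hμ2 hμ0, map_add, map_smul, map_smul, hM]
    simp only [blockValue, smul_eq_mul, Complex.real_smul, ← hμ]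
    push_cast
    field_simp
    ring

/-- The trace of a polynomial in the localizer. -/
theorem trace_aeval_pairLocalizer (h : IsCliffordPair g e) (hk : 0 < k) {κ : ℂ}
    (hκ : (List.ofFn fun j => g j * e j).prod = κ • 1) (τ : A →ₗ[ℂ] ℂ)
    (hτ : ∀ a b, τ (a * b) = τ (b * a)) (x : Fin (k + 1) → ℝ) (p : Polynomial ℂ) :
    τ (Polynomial.aeval (pairLocalizer g e x) p) =
      ∑ s : Fin (k + 1) → ℤˣ, (1 / 2 : ℂ) ^ (k + 1) * (1 + κ * ∏ j, ((s j : ℤ) : ℂ)) * τ 1 *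
        blockValue (fun y : ℝ => p.eval (y : ℂ)) (∑ j, x j ^ 2) (s 0) (tailSum s) := by
  obtain ⟨r, hr, W, hW⟩ := h.exists_similar 0 x
  obtain ⟨P, Q, hsum, hP, hP', hPQ, hQ0, hQ1, hQ⟩ :=
    exists_joint_projections _ h.prod_sq h.prod_comm
  rw [sum_sub_eq] at hW
  have hsim := aeval_mul_of_mul_eq hW p
  have : τ (Polynomial.aeval (pairLocalizer g e x) p) =
      τ (Polynomial.aeval (g 0 * e 0 + tailPart g e r) p) := by
    calc τ (Polynomial.aeval (pairLocalizer g e x) p)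
        = τ (↑W⁻¹ * (W * Polynomial.aeval (pairLocalizer g e x) p)) := by
          rw [Units.inv_mul_cancel_left]
      _ = τ (Polynomial.aeval (g 0 * e 0 + tailPart g e r) p) := by
          rw [hsim, hτ, Units.mul_inv_cancel_right]
  rw [this, ← mul_one (Polynomial.aeval _ p), ← hsum, Finset.mul_sum, map_sum]
  refine Finset.sum_congr rfl fun s _ => ?_
  rw [h.trace_aeval_mul_projection hk τ hτ hP hP', hr,
    h.trace_projection (Nat.succ_pos k) hκ τ hτ hPQ hQ0 hQ1 hQ, hsum]

end IsCliffordPair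

/-! ### Sums over sign vectors -/

section Counting

theorem sum_signs_eq {k : ℕ} (t : Fin k → ℤˣ) :
    ∑ j, (t j : ℤ) = k - 2 * (Finset.univ.filter fun j => t j = -1).card := by
  have : ∀ j, (t j : ℤ) = 1 - 2 * (if t j = -1 then 1 else 0) := by
    intro j
    rcases Int.units_eq_one_or (t j) with h | h <;> rw [h] <;> decide
  rw [Finset.sum_congr rfl fun j _ => this j, Finset.sum_sub_distrib, ← Finset.mul_sum,
    Finset.sum_boole]
  simp

theorem prod_signs_eq {k : ℕ} (t : Fin k → ℤˣ) :
    ∏ j, ((t j : ℤ) : ℝ) = (-1) ^ (Finset.univ.filter fun j => t j = -1).card := by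
  have : ∀ j, ((t j : ℤ) : ℝ) = if t j = -1 then -1 else 1 := by
    intro j
    rcases Int.units_eq_one_or (t j) with h | h
    · rw [h, if_neg (by decide)]; simp
    · rw [h, if_pos rfl]; simp
  rw [Finset.prod_congr rfl fun j _ => this j, Finset.prod_ite]
  simp

theorem sum_signs_eq_zero_iff {m : ℕ} (t : Fin (2 * m) → ℤˣ) :
    ∑ j, (t j : ℤ) = 0 ↔ (Finset.univ.filter fun j => t j = -1).card = m := by
  rw [sum_signs_eq]
  push_cast
  omega

theorem card_sum_signs_eq_zero (m : ℕ) :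
    (Finset.univ.filter fun t : Fin (2 * m) → ℤˣ => ∑ j, (t j : ℤ) = 0).card =
      (2 * m).choose m := by
  have : (Finset.powersetCard m (Finset.univ : Finset (Fin (2 * m)))).card = (2 * m).choose m := by
    simp
  rw [← this]
  refine Finset.card_bij' (fun t _ => Finset.univ.filter fun j => t j = -1)
    (fun S _ j => if j ∈ S then -1 else 1) ?_ ?_ ?_ ?_
  · intro t ht
    rw [Finset.mem_powersetCard]
    exact ⟨Finset.subset_univ _, (sum_signs_eq_zero_iff t).1 (Finset.mem_filter.1 ht).2⟩
  · intro S hS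
    rw [Finset.mem_filter, sum_signs_eq_zero_iff]
    refine ⟨Finset.mem_univ _, Eq.trans (congrArg _ ?_) (Finset.mem_powersetCard.1 hS).2⟩
    ext j
    by_cases hj : j ∈ S <;> simp [hj]
  · intro t _
    funext j
    rcases Int.units_eq_one_or (t j) with h | h <;> simp [h]
  · intro S _
    ext j
    by_cases hj : j ∈ S <;> simp [hj]

/-- A weighted sum over sign vectors, odd in the sum of the tail, only sees the sign vectors whose
tail sums to zero. -/
theorem sum_signs_of_odd (m : ℕ) (Φ : ℤˣ → ℤ → ℝ)
    (hΦ : ∀ u σ, Even σ → σ ≠ 0 → Φ u (-σ) = -Φ u σ) :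
    ∑ s : Fin (2 * m + 1) → ℤˣ, (1 + (-1) ^ m * ∏ j, ((s j : ℤ) : ℝ)) / 2 *
      Φ (s 0) (IsCliffordPair.tailSum s) = ((2 * m).choose m : ℝ) * Φ 1 0 := by
  have hinner : ∀ u : ℤˣ, ∑ t : Fin (2 * m) → ℤˣ,
      (1 + (-1) ^ m * (((u : ℤ) : ℝ) * ∏ j, ((t j : ℤ) : ℝ))) / 2 * Φ u (∑ j, (t j : ℤ)) =
        ((2 * m).choose m : ℝ) * ((1 + ((u : ℤ) : ℝ)) / 2 * Φ u 0) := by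
    intro u
    set G : (Fin (2 * m) → ℤˣ) → ℝ := fun t =>
      (1 + (-1) ^ m * (((u : ℤ) : ℝ) * ∏ j, ((t j : ℤ) : ℝ))) / 2 * Φ u (∑ j, (t j : ℤ)) with hG
    -- Negating the tail reverses its sum but keeps its product, which has an even number of
    -- factors.
    have hneg : ∑ t, G (-t) = ∑ t, G t := Equiv.sum_comp (Equiv.neg (Fin (2 * m) → ℤˣ)) G
    have hpair : ∀ t, G t + G (-t) =
        (if ∑ j, (t j : ℤ) = 0 then 1 else 0) * (2 * ((1 + ((u : ℤ) : ℝ)) / 2 * Φ u 0)) := by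
      intro t
      have hs : ∑ j, ((-t) j : ℤ) = -∑ j, (t j : ℤ) := by simp
      have hp : ∏ j, (((-t) j : ℤ) : ℝ) = ∏ j, ((t j : ℤ) : ℝ) := by
        simp [Finset.prod_neg]
      simp only [hG, hs, hp]
      split_ifs with h0
      -- A zero sum means exactly `m` minus signs, so the weight becomes `(1 + u) / 2` and only `u =
      -- 1` will survive.
      · rw [h0, prod_signs_eq, (sum_signs_eq_zero_iff t).1 h0]
        have : ((-1 : ℝ) ^ m) * (-1) ^ m = 1 := by rw [← mul_pow]; simp
        rw [neg_zero]
        linear_combination (((u : ℤ) : ℝ) * Φ u 0) * this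
      · have hev : Even (∑ j, (t j : ℤ)) := by
          rw [sum_signs_eq]
          exact ⟨m - (Finset.univ.filter fun j => t j = -1).card, by push_cast; ring⟩
        rw [hΦ u _ hev h0]
        ring
    have h2 : 2 * ∑ t, G t = ∑ t, (G t + G (-t)) := by
      rw [Finset.sum_add_distrib, hneg]; ring
    rw [Finset.sum_congr rfl fun t _ => hpair t, ← Finset.sum_mul, Finset.sum_boole,
      card_sum_signs_eq_zero] at h2
    linarith
  rw [← Equiv.sum_comp (Fin.consEquiv fun _ : Fin (2 * m + 1) => ℤˣ), Fintype.sum_prod_type]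
  simp only [Fin.consEquiv, Equiv.coe_fn_mk, Fin.prod_univ_succ, Fin.cons_zero, Fin.cons_succ,
    IsCliffordPair.tailSum]
  rw [Finset.sum_congr rfl fun u _ => hinner u, UnitsInt.univ, Finset.sum_pair (by decide)]
  simp

theorem one_lt_sqrt_of_even {q : ℝ} (hq : 0 ≤ q) {σ : ℤ} (h : Even σ) (h0 : σ ≠ 0) :
    1 < √((σ : ℝ) ^ 2 + q) := by
  rw [Real.lt_sqrt zero_le_one]
  linarith [IsCliffordPair.four_le_sq_of_even h h0]

/-- For even `σ ≠ 0` the root exceeds `1 = |u|`, so the two eigenvalues have opposite signs and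
average to `σ / √(σ² + q)`, odd in `σ`. For `σ = 0`, `u = 1` the signs of `1 ± √q` decide. -/
theorem sum_signs_blockValue_sign (m : ℕ) {q : ℝ} (hq : 0 ≤ q) :
    (q < 1 → ∑ s : Fin (2 * m + 1) → ℤˣ, (1 + (-1) ^ m * ∏ j, ((s j : ℤ) : ℝ)) / 2 *
      blockValue (fun y => (SignType.sign y : ℝ)) q (s 0) (IsCliffordPair.tailSum s) =
        (2 * m).choose m) ∧
    (1 < q → ∑ s : Fin (2 * m + 1) → ℤˣ, (1 + (-1) ^ m * ∏ j, ((s j : ℤ) : ℝ)) / 2 *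
      blockValue (fun y => (SignType.sign y : ℝ)) q (s 0) (IsCliffordPair.tailSum s) = 0) := by
  have hval : ∀ (u : ℤˣ) (σ : ℤ), Even σ → σ ≠ 0 →
      blockValue (fun y => (SignType.sign y : ℝ)) q u σ = σ / √((σ : ℝ) ^ 2 + q) := by
    intro u σ h h0
    have h1 := one_lt_sqrt_of_even hq h h0
    have hu : |((u : ℤ) : ℝ)| = 1 := by
      rcases Int.units_eq_one_or u with rfl | rfl <;> simp
    obtain ⟨ha, hb⟩ := abs_le.1 hu.le
    rw [blockValue, sign_pos (by linarith), sign_neg (by linarith)]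
    simp only [smul_eq_mul, SignType.coe_one, SignType.coe_neg]
    ring
  have hodd : ∀ (u : ℤˣ) (σ : ℤ), Even σ → σ ≠ 0 →
      blockValue (fun y => (SignType.sign y : ℝ)) q u (-σ) =
        -blockValue (fun y => (SignType.sign y : ℝ)) q u σ := by
    intro u σ h h0
    rw [hval u σ h h0, hval u (-σ) h.neg (neg_ne_zero.2 h0)]
    push_cast
    rw [neg_sq, neg_div]
  have hzero : blockValue (fun y => (SignType.sign y : ℝ)) q 1 0 =
      (1 + (SignType.sign (1 - √q) : ℝ)) / 2 := by
    have : 0 < 1 + √q := by positivity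
    simp [blockValue, sign_pos this]
    ring
  rw [sum_signs_of_odd m _ hodd, hzero]
  constructor
  · intro h
    have : √q < 1 := by rw [Real.sqrt_lt' one_pos]; simpa using h
    rw [sign_pos (by linarith)]
    simp
  · intro h
    have : 1 < √q := by rw [Real.lt_sqrt zero_le_one]; simpa using h
    rw [sign_neg (by linarith)]
    simp

/-- This is the nullity on the sphere: for `σ = 0`, `u = 1` the eigenvalues are `2` and `0`, each
with weight `1/2`. -/
theorem sum_signs_blockValue_zero (m : ℕ) :
    ∑ s : Fin (2 * m + 1) → ℤˣ, (1 + (-1) ^ m * ∏ j, ((s j : ℤ) : ℝ)) / 2 *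
      blockValue (fun y : ℝ => if y = 0 then (1 : ℝ) else 0) 1 (s 0) (IsCliffordPair.tailSum s) =
        (2 * m).choose m / 2 := by
  have hval : ∀ (u : ℤˣ) (σ : ℤ), Even σ → σ ≠ 0 →
      blockValue (fun y : ℝ => if y = 0 then (1 : ℝ) else 0) 1 u σ = 0 := by
    intro u σ h h0
    have h1 := one_lt_sqrt_of_even zero_le_one h h0
    have hu : |((u : ℤ) : ℝ)| = 1 := by
      rcases Int.units_eq_one_or u with rfl | rfl <;> simp
    obtain ⟨ha, hb⟩ := abs_le.1 hu.le
    rw [blockValue, if_neg (by linarith), if_neg (by linarith)]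
    simp
  rw [sum_signs_of_odd m _ fun u σ h h0 => by
    rw [hval u σ h h0, hval u (-σ) h.neg (neg_ne_zero.2 h0), neg_zero]]
  norm_num [blockValue]
  ring

end Counting

/-! ### From polynomial traces to eigenvalue counts -/

section Eigenvalues

variable {ι : Type} [Fintype ι] [DecidableEq ι]

theorem trace_aeval_eq_sum_eigenvalues {M : Matrix ι ι ℂ} (hM : M.IsHermitian)
    (p : Polynomial ℂ) :
    (Polynomial.aeval M p).trace = ∑ i, p.eval ((hM.eigenvalues i : ℝ) : ℂ) := by
  conv_lhs => rw [hM.spectral_theorem]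
  rw [Polynomial.aeval_algHom_apply, Unitary.conjStarAlgAut_apply, Matrix.trace_mul_cycle]
  have : Matrix.diagonal (RCLike.ofReal ∘ hM.eigenvalues) =
      Matrix.diagonalAlgHom ℂ (fun i => ((hM.eigenvalues i : ℝ) : ℂ)) := rfl
  rw [this, Polynomial.aeval_algHom_apply]
  simp [Matrix.trace, Polynomial.aeval_pi]

/-- A formula for the traces of all polynomials in a Hermitian matrix extends to arbitrary
functions of its eigenvalues. -/
theorem sum_eigenvalues_eq {M : Matrix ι ι ℂ} (hM : M.IsHermitian) {J : Type*} [Fintype J]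
    (w : J → ℝ) (q : ℝ) (u : J → ℤˣ) (σ : J → ℤ)
    (h : ∀ p : Polynomial ℂ, (Polynomial.aeval M p).trace =
      ∑ s, (w s : ℂ) * blockValue (fun y : ℝ => p.eval (y : ℂ)) q (u s) (σ s)) (f : ℝ → ℝ) :
    ∑ i, f (hM.eigenvalues i) = ∑ s, w s * blockValue f q (u s) (σ s) := by
  classical
  -- The nodes include actual and predicted eigenvalues alike, so the interpolant agrees with `f`
  -- wherever either side evaluates it.
  set N : Finset ℝ := Finset.univ.image hM.eigenvalues ∪
    (Finset.univ.image (fun s => ((u s : ℤ) : ℝ) + √((σ s : ℝ) ^ 2 + q)) ∪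
      Finset.univ.image (fun s => ((u s : ℤ) : ℝ) - √((σ s : ℝ) ^ 2 + q))) with hN
  set p := Lagrange.interpolate N (fun y : ℝ => (y : ℂ)) (fun y => (f y : ℂ)) with hp
  have hev : ∀ y ∈ N, p.eval (y : ℂ) = (f y : ℂ) := fun y hy =>
    Lagrange.eval_interpolate_at_node (v := fun y : ℝ => (y : ℂ)) (fun y => (f y : ℂ))
      Complex.ofReal_injective.injOn hy
  have h1 := h p
  rw [trace_aeval_eq_sum_eigenvalues hM] at h1
  have h2 : ∀ i, p.eval ((hM.eigenvalues i : ℝ) : ℂ) = (f (hM.eigenvalues i) : ℂ) := fun i =>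
    hev _ (by simp [hN])
  have h3 : ∀ s, blockValue (fun y : ℝ => p.eval (y : ℂ)) q (u s) (σ s) =
      ((blockValue f q (u s) (σ s) : ℝ) : ℂ) := by
    intro s
    simp only [blockValue]
    rw [hev _ (by simp [hN]), hev _ (by simp [hN])]
    simp [Complex.real_smul]
  simp only [h2, h3] at h1
  exact_mod_cast h1

theorem signature_eq_sum_sign {M : Matrix ι ι ℂ} (hM : M.IsHermitian) :
    (signature M hM : ℝ) = ∑ i, (SignType.sign (hM.eigenvalues i) : ℝ) := by
  have : ∀ y : ℝ, (SignType.sign y : ℝ) = (if 0 < y then 1 else 0) - (if y < 0 then 1 else 0) := by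
    intro y
    rcases lt_trichotomy y 0 with h | h | h
    · simp [sign_neg h, h, h.not_gt]
    · simp [h]
    · simp [sign_pos h, h, h.not_gt]
  simp only [this, Finset.sum_sub_distrib, Finset.sum_boole, signature]
  push_cast
  rfl

end Eigenvalues

/-! ### The product of all generators -/

section Volume

variable {A : Type*} [Ring A] [Algebra ℂ A] {d : ℕ} {f : Fin d → A}

theorem mul_list_prod_eq_smul (a : A) (c : Fin d → ℂ) (l : List (Fin d))
    (h : ∀ j ∈ l, a * f j = c j • (f j * a)) :
    a * (l.map f).prod = (l.map c).prod • ((l.map f).prod * a) := by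
  induction l with
  | nil => simp
  | cons b l ih =>
    rw [List.forall_mem_cons] at h
    simp only [List.map_cons, List.prod_cons]
    rw [← mul_assoc, h.1, smul_mul_assoc, mul_assoc, ih h.2, mul_smul_comm, smul_smul, mul_assoc]

/-- Moving the head past a tail of length `l` costs `(-1)^l`; the exponents add up to a triangular
number. -/
theorem list_prod_sq (hsq : ∀ j, f j * f j = 1)
    (hanti : ∀ i j, i ≠ j → f i * f j = -(f j * f i)) (l : List (Fin d)) (hl : l.Nodup) :
    (l.map f).prod * (l.map f).prod = ((-1 : ℂ) ^ (l.length.choose 2)) • 1 := by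
  induction l with
  | nil => simp
  | cons a l ih =>
    rw [List.nodup_cons] at hl
    have h1 := mul_list_prod_eq_smul (f := f) (f a) (fun _ => -1) l fun j hj => by
      rw [neg_one_smul]
      exact hanti a j (by rintro rfl; exact hl.1 hj)
    rw [List.map_const', List.prod_replicate] at h1
    simp only [List.map_cons, List.prod_cons, List.length_cons]
    nth_rewrite 1 [h1]
    rw [smul_mul_assoc, mul_assoc, ← mul_assoc (f a), hsq, one_mul, ih hl.2, smul_smul, ← pow_add,
      Nat.choose_succ_succ' l.length 1, Nat.choose_one_right]

theorem ofFn_prod_sq {m : ℕ} {f : Fin (2 * m + 1) → A} (hsq : ∀ j, f j * f j = 1)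
    (hanti : ∀ i j, i ≠ j → f i * f j = -(f j * f i)) :
    (List.ofFn f).prod * (List.ofFn f).prod = ((-1 : ℂ) ^ m) • 1 := by
  rw [List.ofFn_eq_map, list_prod_sq hsq hanti _ (List.nodup_finRange _), List.length_finRange,
    Nat.choose_two_right]
  congr 1
  have : (2 * m + 1) * (2 * m + 1 - 1) / 2 = 2 * (m * m) + m := by
    rw [Nat.add_sub_cancel]
    exact Nat.div_eq_of_eq_mul_left two_pos (by ring)
  rw [this, pow_add, pow_mul]
  simp

/-- Each generator anticommutes with the `2m` others, an even number. By Schur's lemma the product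
is then scalar in an irreducible representation. -/
theorem commute_ofFn_prod {m : ℕ} {f : Fin (2 * m + 1) → A}
    (hanti : ∀ i j, i ≠ j → f i * f j = -(f j * f i)) (i : Fin (2 * m + 1)) :
    f i * (List.ofFn f).prod = (List.ofFn f).prod * f i := by
  have h := mul_list_prod_eq_smul (f := f) (f i) (fun j => if i = j then 1 else -1)
    (List.finRange _) fun j _ => by
      split_ifs with hij
      · subst hij; rw [one_smul]
      · rw [neg_one_smul, hanti i j hij]
  rw [← List.ofFn_eq_map, ← List.ofFn_eq_map, List.prod_ofFn, Finset.prod_ite,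
    Finset.prod_const_one, one_mul, Finset.prod_const, Finset.filter_ne, Finset.card_erase_of_mem
    (Finset.mem_univ i), Finset.card_univ, Fintype.card_fin, Nat.add_sub_cancel, pow_mul] at h
  simpa using h

theorem list_prod_mul_reverse_prod {A : Type*} [Monoid A] (l : List A) (h : ∀ a ∈ l, a * a = 1) :
    l.prod * l.reverse.prod = 1 := by
  induction l with
  | nil => simp
  | cons a l ih =>
    rw [List.forall_mem_cons] at h
    rw [List.reverse_cons, List.prod_append, List.prod_cons, List.prod_singleton, mul_assoc,
      ← mul_assoc l.prod, ih h.2, one_mul, h.1]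

end Volume

/-! ### Sign and dimension of irreducible representations -/

section Representations

variable {n : ℕ}

/-- A product of involutions is inverse to its reversal, so the reversed product can be moved across
the equation. -/
theorem hasCliffordSign_iff {k : ℕ} {γ : Fin (k + 1) → Matrix (Fin n) (Fin n) ℂ}
    (hγ : IsCliffordRep γ) (ε : ℂ) :
    HasCliffordSign γ ε ↔ (List.ofFn γ).prod = ε • 1 := by
  set l := List.ofFn fun i : Fin k => γ i.castSucc with hl
  have hsq : ∀ a ∈ l, a * a = 1 := by
    intro a ha
    obtain ⟨j, rfl⟩ := (List.mem_ofFn' _ _).1 ha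
    exact hγ.mul_self _
  have h1 : l.prod * l.reverse.prod = 1 := list_prod_mul_reverse_prod l hsq
  have h2 : l.reverse.prod * l.prod = 1 := by
    simpa using list_prod_mul_reverse_prod l.reverse (by simpa using hsq)
  have hsplit : List.ofFn γ = l ++ [γ (Fin.last k)] := by
    rw [List.ofFn_succ', List.concat_eq_append]
  have hsign : HasCliffordSign γ ε ↔ γ (Fin.last k) = ε • l.reverse.prod := by
    unfold HasCliffordSign
    rw [hsplit, List.dropLast_concat]
    constructor
    · intro h; exact h _ (by simp)
    · intro h j hj
      have : j = Fin.last k := Fin.ext (by simpa using hj)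
      rw [this, h]
  rw [hsign, hsplit, List.prod_append, List.prod_singleton]
  constructor
  · intro h
    rw [h, mul_smul_comm, h1]
  · intro h
    calc γ (Fin.last k) = l.reverse.prod * (l.prod * γ (Fin.last k)) := by
          rw [← mul_assoc, h2, one_mul]
      _ = ε • l.reverse.prod := by rw [h, mul_smul_comm, mul_one]

/-- Schur's lemma for irreducible representations of the Clifford relations. -/
theorem IsIrredCliffordRep.exists_eq_smul_one {d : ℕ} {γ : Fin d → Matrix (Fin n) (Fin n) ℂ}
    (hγ : IsIrredCliffordRep γ) (X : Matrix (Fin n) (Fin n) ℂ) (hX : ∀ j, γ j * X = X * γ j) :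
    ∃ c : ℂ, X = c • 1 := by
  have : Nonempty (Fin n) := ⟨⟨0, hγ.pos⟩⟩
  obtain ⟨c, hc⟩ := Module.End.exists_eigenvalue (Matrix.toLin' X)
  refine ⟨c, ?_⟩
  have hW := hγ.irred (Module.End.eigenspace (Matrix.toLin' X) c) fun j v hv => by
    rw [Module.End.mem_eigenspace_iff, Matrix.toLin'_apply] at hv ⊢
    rw [Matrix.mulVec_mulVec, ← hX, ← Matrix.mulVec_mulVec, hv, Matrix.mulVec_smul]
  rcases hW with h | h
  · exact absurd h hc
  · apply Matrix.toLin'.injective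
    refine LinearMap.ext fun v => ?_
    have hv : v ∈ Module.End.eigenspace (Matrix.toLin' X) c := h ▸ Submodule.mem_top
    rw [Module.End.mem_eigenspace_iff.1 hv]
    simp

theorem IsIrredCliffordRep.exists_sign {m : ℕ} {γ : Fin (2 * m + 1) → Matrix (Fin n) (Fin n) ℂ}
    (hγ : IsIrredCliffordRep γ) : ∃ ε : ℂ, HasCliffordSign γ ε := by
  obtain ⟨ε, hε⟩ := hγ.exists_eq_smul_one _ (commute_ofFn_prod hγ.anticomm)
  exact ⟨ε, (hasCliffordSign_iff hγ.toIsCliffordRep ε).2 hε⟩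

theorem IsIrredCliffordRep.sign_sq {m : ℕ} {γ : Fin (2 * m + 1) → Matrix (Fin n) (Fin n) ℂ}
    (hγ : IsIrredCliffordRep γ) {ε : ℂ} (hε : HasCliffordSign γ ε) : ε * ε = (-1) ^ m := by
  have : Nonempty (Fin n) := ⟨⟨0, hγ.pos⟩⟩
  have h := ofFn_prod_sq hγ.mul_self hγ.anticomm
  rw [(hasCliffordSign_iff hγ.toIsCliffordRep ε).1 hε, smul_mul_smul_comm, mul_one] at h
  exact smul_left_injective ℂ (one_ne_zero' (Matrix (Fin n) (Fin n) ℂ)) h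

/-- The products of this pair are the conjugations `X ↦ γ_j X γ_j`, whose common fixed points form
the commutant. -/
theorem IsCliffordRep.isCliffordPair_mul {d : ℕ} {γ : Fin d → Matrix (Fin n) (Fin n) ℂ}
    (hγ : IsCliffordRep γ) :
    IsCliffordPair (A := Module.End ℂ (Matrix (Fin n) (Fin n) ℂ))
      (fun j => LinearMap.mulLeft ℂ (γ j)) (fun j => LinearMap.mulRight ℂ (γ j)) where
  g_sq j := by ext1 X; simp [← mul_assoc, hγ.mul_self]
  e_sq j := by ext1 X; simp [mul_assoc, hγ.mul_self]
  g_anti i j hij := by ext1 X; simp [← mul_assoc, hγ.anticomm i j hij]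
  e_anti i j hij := by ext1 X; simp [mul_assoc, hγ.anticomm i j hij]
  comm i j := by ext1 X; simp [mul_assoc]

/-- The dimension of an irreducible representation. -/
theorem IsIrredCliffordRep.dim_sq {m : ℕ} {γ : Fin (2 * m + 1) → Matrix (Fin n) (Fin n) ℂ}
    (hγ : IsIrredCliffordRep γ) : n * n = 2 ^ (2 * m) := by
  have hne : Nonempty (Fin n) := ⟨⟨0, hγ.pos⟩⟩
  have h := hγ.toIsCliffordRep.isCliffordPair_mul
  obtain ⟨ε, hε⟩ := hγ.exists_sign
  rw [hasCliffordSign_iff hγ.toIsCliffordRep] at hε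
  obtain ⟨P, Q, hsum, hP, hP', hPQ, hQ0, hQ1, hQ⟩ :=
    exists_joint_projections _ h.prod_sq h.prod_comm
  have happly : ∀ (l : List (Fin (2 * m + 1))) (X : Matrix (Fin n) (Fin n) ℂ),
      (l.map fun j => LinearMap.mulLeft ℂ (γ j) * LinearMap.mulRight ℂ (γ j)).prod X =
        (l.map γ).prod * X * (l.map γ).reverse.prod := by
    intro l X
    induction l with
    | nil => simp
    | cons a l ih => simp [ih, mul_assoc]
  have hκ : (List.ofFn fun j => LinearMap.mulLeft ℂ (γ j) * LinearMap.mulRight ℂ (γ j)).prod =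
      (1 : ℂ) • (1 : Module.End ℂ (Matrix (Fin n) (Fin n) ℂ)) := by
    ext1 X
    have hrev : (List.ofFn γ).prod * (List.ofFn γ).reverse.prod = 1 :=
      list_prod_mul_reverse_prod _ fun a ha => by
        obtain ⟨j, rfl⟩ := (List.mem_ofFn' _ _).1 ha
        exact hγ.mul_self _
    rw [List.ofFn_eq_map, happly, ← List.ofFn_eq_map, hε, smul_mul_assoc, one_mul,
      smul_mul_assoc, ← mul_smul_comm, ← one_mul (List.ofFn γ).reverse.prod, ← smul_mul_assoc, ← hε,
      hrev]
    simp
  have htr := h.trace_projection (Nat.succ_pos _) hκ (LinearMap.trace ℂ _)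
    (LinearMap.trace_mul_comm ℂ) hPQ hQ0 hQ1 hQ 1
  -- By Schur's lemma the commutant is the line of scalars, so `P 1` has trace `1`; the trace
  -- formula gives `2 n² / 2^(2m+1)`.
  have hproj : LinearMap.IsProj (Submodule.span ℂ {(1 : Matrix (Fin n) (Fin n) ℂ)}) (P 1) := by
    constructor
    · intro X
      obtain ⟨c, hc⟩ := hγ.exists_eq_smul_one (P 1 X) fun j => by
        have := LinearMap.congr_fun (hP 1 j) X
        simp only [Module.End.mul_apply, LinearMap.mulLeft_apply, LinearMap.mulRight_apply,
          Pi.one_apply, Units.val_one, Int.cast_one, one_smul] at this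
        calc γ j * P 1 X = γ j * (P 1 X * γ j * γ j) := by
              rw [mul_assoc, hγ.mul_self, mul_one]
          _ = P 1 X * γ j := by rw [← mul_assoc, this]
      rw [hc]
      exact Submodule.smul_mem _ _ (Submodule.mem_span_singleton_self _)
    · have hone : P 1 1 = 1 := by
        have h1 := LinearMap.congr_fun hsum 1
        rw [LinearMap.sum_apply, Finset.sum_eq_single 1] at h1
        · simpa using h1
        · intro s _ hs
          obtain ⟨j, hj⟩ := Function.ne_iff.1 hs
          have hj' : s j = -1 := (Int.units_eq_one_or (s j)).resolve_left hj
          have := LinearMap.congr_fun (hP' s j) 1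
          simp [hj', hγ.mul_self] at this
          refine smul_right_injective _ (two_ne_zero' ℂ) ?_
          simp only [smul_zero, two_smul]
          exact add_eq_zero_iff_eq_neg.2 this
        · simp
      intro X hX
      obtain ⟨c, rfl⟩ := Submodule.mem_span_singleton.1 hX
      rw [map_smul, hone]
  rw [hproj.trace, finrank_span_singleton one_ne_zero, LinearMap.trace_one] at htr
  simp [Module.finrank_matrix] at htr
  rw [pow_succ] at htr
  field_simp at htr
  norm_num at htr
  have : (2 : ℂ) ^ (2 * m) = n * n := by linear_combination htr / 2
  exact_mod_cast this.symm

end Representations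

/-! ### Matrix and universal localizers as Clifford pairs -/

section Localizer

variable {d n r : ℕ}

theorem IsCliffordRep.isCliffordPair_kronecker {γ : Fin d → Matrix (Fin n) (Fin n) ℂ}
    {ρ : Fin d → Matrix (Fin r) (Fin r) ℂ} (hγ : IsCliffordRep γ) (hρ : IsCliffordRep ρ) :
    IsCliffordPair (fun j => γ j ⊗ₖ (1 : Matrix (Fin r) (Fin r) ℂ))
      (fun j => (1 : Matrix (Fin n) (Fin n) ℂ) ⊗ₖ ρ j) where
  g_sq j := by simp [← Matrix.mul_kronecker_mul, hγ.mul_self]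
  e_sq j := by simp [← Matrix.mul_kronecker_mul, hρ.mul_self]
  g_anti i j hij := by
    rw [← Matrix.mul_kronecker_mul, ← Matrix.mul_kronecker_mul, hγ.anticomm i j hij]
    ext a b
    simp [Matrix.kroneckerMap_apply]
  e_anti i j hij := by
    rw [← Matrix.mul_kronecker_mul, ← Matrix.mul_kronecker_mul, hρ.anticomm i j hij]
    ext a b
    simp [Matrix.kroneckerMap_apply]
  comm i j := by simp [← Matrix.mul_kronecker_mul]

theorem localizer_eq_pairLocalizer (γ : Fin d → Matrix (Fin n) (Fin n) ℂ)
    (ρ : Fin d → Matrix (Fin r) (Fin r) ℂ) (x : EuclideanSpace ℝ (Fin d)) :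
    localizer ρ γ x = pairLocalizer (fun j => γ j ⊗ₖ (1 : Matrix (Fin r) (Fin r) ℂ))
      (fun j => (1 : Matrix (Fin n) (Fin n) ℂ) ⊗ₖ ρ j) (fun j => x j) := by
  rw [localizer, pairLocalizer, cliffordVec, ← Finset.sum_sub_distrib]
  refine Finset.sum_congr rfl fun j _ => ?_
  rw [← Matrix.mul_kronecker_mul, mul_one, one_mul, ← Matrix.smul_kronecker]
  ext a b
  simp [Matrix.kroneckerMap_apply, sub_mul]

theorem list_prod_kronecker_one (l : List (Matrix (Fin n) (Fin n) ℂ)) :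
    (l.map fun X => X ⊗ₖ (1 : Matrix (Fin r) (Fin r) ℂ)).prod = l.prod ⊗ₖ 1 := by
  induction l with
  | nil => simp
  | cons a l ih => simp [ih, ← Matrix.mul_kronecker_mul]

theorem list_prod_one_kronecker (l : List (Matrix (Fin r) (Fin r) ℂ)) :
    (l.map fun X => (1 : Matrix (Fin n) (Fin n) ℂ) ⊗ₖ X).prod = 1 ⊗ₖ l.prod := by
  induction l with
  | nil => simp
  | cons a l ih => simp [ih, ← Matrix.mul_kronecker_mul]

theorem isCliffordPair_tmul {γ : Fin d → Matrix (Fin n) (Fin n) ℂ} (hγ : IsCliffordRep γ) :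
    IsCliffordPair (fun j => γ j ⊗ₜ[ℂ] (1 : Cl d))
      (fun j => (1 : Matrix (Fin n) (Fin n) ℂ) ⊗ₜ[ℂ] (gen j : Cl d)) where
  g_sq j := by simp [hγ.mul_self, Algebra.TensorProduct.one_def]
  e_sq j := by simp [gen_sq, Algebra.TensorProduct.one_def]
  g_anti i j hij := by simp [hγ.anticomm i j hij, TensorProduct.neg_tmul]
  e_anti i j hij := by simp [gen_anticomm hij, TensorProduct.tmul_neg]
  comm i j := by simp

theorem universalLocalizer_eq_pairLocalizer (γ : Fin d → Matrix (Fin n) (Fin n) ℂ)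
    (x : EuclideanSpace ℝ (Fin d)) :
    universalLocalizer γ x = pairLocalizer (fun j => γ j ⊗ₜ[ℂ] (1 : Cl d))
      (fun j => (1 : Matrix (Fin n) (Fin n) ℂ) ⊗ₜ[ℂ] (gen j : Cl d)) (fun j => x j) := by
  rw [universalLocalizer, pairLocalizer, cliffordVec, ← Finset.sum_sub_distrib]
  refine Finset.sum_congr rfl fun j _ => ?_
  rw [Algebra.TensorProduct.tmul_mul_tmul, mul_one, one_mul, TensorProduct.sub_tmul,
    TensorProduct.smul_tmul']

/-- The representation of the Clifford algebra with prescribed images of the generators. -/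
theorem IsCliffordRep.exists_algHom {γ : Fin d → Matrix (Fin n) (Fin n) ℂ}
    (hγ : IsCliffordRep γ) :
    ∃ φ : Cl d →ₐ[ℂ] Matrix (Fin n) (Fin n) ℂ, ∀ j, φ (gen j) = γ j := by
  refine ⟨CliffordAlgebra.lift (stdForm d) ⟨Fintype.linearCombination ℂ γ, fun c => ?_⟩,
    fun j => ?_⟩
  · rw [Fintype.linearCombination_apply, sum_smul_mul_self hγ.mul_self hγ.anticomm,
      Algebra.algebraMap_eq_smul_one]
    congr 1
    simp [stdForm, QuadraticMap.weightedSumSquares_apply, pow_two]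
  · rw [gen, CliffordAlgebra.lift_ι_apply, Fintype.linearCombination_apply_single, one_smul]

/-- The homomorphism `id ⊗ φ` induced by `ρ` preserves units. Contrapositively, one singular matrix
localizer puts the point in the Clifford spectrum. -/
theorem isUnit_localizer_of_isUnit_universalLocalizer {A : Fin d → Matrix (Fin n) (Fin n) ℂ}
    {ρ : Fin d → Matrix (Fin r) (Fin r) ℂ} (hρ : IsCliffordRep ρ) {x : EuclideanSpace ℝ (Fin d)}
    (h : IsUnit (universalLocalizer A x)) : IsUnit (localizer ρ A x) := by
  obtain ⟨φ, hφ⟩ := hρ.exists_algHom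
  have h1 := (h.map (Algebra.TensorProduct.map (AlgHom.id ℂ (Matrix (Fin n) (Fin n) ℂ)) φ)).map
    (Matrix.kroneckerAlgEquiv (Fin n) (Fin r) ℂ)
  convert h1 using 1
  simp only [universalLocalizer, localizer, map_sum, Algebra.TensorProduct.map_tmul, hφ]
  rfl

end Localizer

/-! ### Spectrum and signature in odd dimension -/

section OddDimension

variable {m n r : ℕ} {γ : Fin (2 * m + 1) → Matrix (Fin n) (Fin n) ℂ}
  {ρ : Fin (2 * m + 1) → Matrix (Fin r) (Fin r) ℂ}

/-- The eigenvalues of the localizer of an irreducible representation. -/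
theorem sum_eigenvalues_localizer (hm : 0 < m) (hγ : IsIrredCliffordRep γ)
    (hρ : IsIrredCliffordRep ρ) {ε : ℂ} (hγε : HasCliffordSign γ ε) (hρε : HasCliffordSign ρ ε)
    (x : EuclideanSpace ℝ (Fin (2 * m + 1))) (hL : (localizer ρ γ x).IsHermitian) (f : ℝ → ℝ) :
    ∑ i, f (hL.eigenvalues i) = ∑ s : Fin (2 * m + 1) → ℤˣ,
      (1 + (-1) ^ m * ∏ j, ((s j : ℤ) : ℝ)) / 2 *
        blockValue f (‖x‖ ^ 2) (s 0) (IsCliffordPair.tailSum s) := by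
  have h := hγ.toIsCliffordRep.isCliffordPair_kronecker hρ.toIsCliffordRep
  have hκ := h.ofFn_prod
  have e1 := list_prod_kronecker_one (r := r) (List.ofFn γ)
  have e2 := list_prod_one_kronecker (n := n) (List.ofFn ρ)
  rw [List.map_ofFn, (hasCliffordSign_iff hγ.toIsCliffordRep ε).1 hγε] at e1
  rw [List.map_ofFn, (hasCliffordSign_iff hρ.toIsCliffordRep ε).1 hρε] at e2
  simp only [Function.comp_def] at e1 e2
  -- The common sign convention enters here: the full product is `ε² = (-1)^m`, whereas opposite
  -- signs would give `-(-1)^m`.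
  rw [e1, e2, ← Matrix.mul_kronecker_mul, one_mul, mul_one, Matrix.smul_kronecker,
    Matrix.kronecker_smul, smul_smul, Matrix.one_kronecker_one, hγ.sign_sq hγε] at hκ
  have hn := hγ.dim_sq
  have hr := hρ.dim_sq
  have hnr : n = r := Nat.mul_self_inj.1 (hn.trans hr.symm)
  have hone : Matrix.traceLinearMap (Fin n × Fin r) ℂ ℂ 1 = (2 : ℂ) ^ (2 * m) := by
    rw [Matrix.traceLinearMap_apply, Matrix.trace_one, Fintype.card_prod, Fintype.card_fin,
      Fintype.card_fin, ← hnr, hn]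
    push_cast
    rfl
  refine sum_eigenvalues_eq hL _ _ _ _ (fun p => ?_) f
  have ht := h.trace_aeval_pairLocalizer (by omega) hκ (Matrix.traceLinearMap _ ℂ ℂ)
    (fun a b => Matrix.trace_mul_comm a b) (fun j => x j) p
  rw [← localizer_eq_pairLocalizer, Matrix.traceLinearMap_apply] at ht
  rw [ht]
  refine Finset.sum_congr rfl fun s _ => ?_
  rw [hone, EuclideanSpace.real_norm_sq_eq]
  congr 1
  push_cast
  rw [one_div, inv_pow, pow_succ]
  field_simp

theorem signature_localizer (hm : 0 < m) (hγ : IsIrredCliffordRep γ)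
    (hρ : IsIrredCliffordRep ρ) {ε : ℂ} (hγε : HasCliffordSign γ ε) (hρε : HasCliffordSign ρ ε)
    (x : EuclideanSpace ℝ (Fin (2 * m + 1))) (hL : (localizer ρ γ x).IsHermitian) :
    (‖x‖ < 1 → signature (localizer ρ γ x) hL = ((2 * m).choose m : ℤ)) ∧
    (1 < ‖x‖ → signature (localizer ρ γ x) hL = 0) := by
  have h := signature_eq_sum_sign hL
  rw [sum_eigenvalues_localizer hm hγ hρ hγε hρε x hL fun y => (SignType.sign y : ℝ)] at h
  obtain ⟨h1, h2⟩ := sum_signs_blockValue_sign m (sq_nonneg ‖x‖)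
  constructor
  · intro hx
    rw [h1 (by rwa [sq_lt_one_iff₀ (norm_nonneg x)])] at h
    exact_mod_cast h
  · intro hx
    rw [h2 (by rwa [one_lt_sq_iff₀ (norm_nonneg x)])] at h
    exact_mod_cast h

/-- The eigenvalue formula for the indicator function of `0` counts half of `C(2m, m)` zero
eigenvalues, a positive number. -/
theorem not_isUnit_localizer (hm : 0 < m) (hγ : IsIrredCliffordRep γ)
    {x : EuclideanSpace ℝ (Fin (2 * m + 1))} (hx : ‖x‖ = 1) : ¬ IsUnit (localizer γ γ x) := by
  intro hu
  have hL := localizer_isHermitian hγ.isHermitian hγ.isHermitian x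
  obtain ⟨ε, hε⟩ := hγ.exists_sign
  have h := sum_eigenvalues_localizer hm hγ hγ hε hε x hL fun y => if y = 0 then (1 : ℝ) else 0
  rw [hx, one_pow, sum_signs_blockValue_zero] at h
  have hdet : (localizer γ γ x).det ≠ 0 := ((Matrix.isUnit_iff_isUnit_det _).1 hu).ne_zero
  rw [hL.det_eq_prod_eigenvalues, Finset.prod_ne_zero_iff] at hdet
  have hne : ∀ i, hL.eigenvalues i ≠ 0 := fun i hi => hdet i (Finset.mem_univ i) (by simp [hi])
  have hpos : (0 : ℝ) < (2 * m).choose m := by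
    exact_mod_cast Nat.choose_pos (by omega)
  simp only [hne, if_false, Finset.sum_const_zero] at h
  linarith

theorem cliffordSpectrum_eq_sphere (hm : 0 < m) (hγ : IsIrredCliffordRep γ) :
    cliffordSpectrum γ = Metric.sphere (0 : EuclideanSpace ℝ (Fin (2 * m + 1))) 1 := by
  ext x
  rw [mem_sphere_zero_iff_norm, cliffordSpectrum, Set.mem_ofPred_eq]
  constructor
  · intro h
    by_contra hx
    apply h
    rw [universalLocalizer_eq_pairLocalizer]
    refine (isCliffordPair_tmul hγ.toIsCliffordRep).isUnit_pairLocalizer (even_two_mul m) _ ?_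
    rw [← EuclideanSpace.real_norm_sq_eq]
    rwa [Ne, pow_eq_one_iff_of_nonneg (norm_nonneg x) two_ne_zero]
  · intro hx h
    exact not_isUnit_localizer hm hγ hx
      (isUnit_localizer_of_isUnit_universalLocalizer hγ.toIsCliffordRep h)

end OddDimension

end CliffordSpec

theorem mainTheorem1 (d : ℕ) (hd : 3 ≤ d) (hodd : Odd d) (n : ℕ)
    (γ : Fin d → Matrix (Fin n) (Fin n) ℂ) (hγ : CliffordSpec.IsIrredCliffordRep γ) :
    -- the Clifford spectrum is the unit sphere
    CliffordSpec.cliffordSpectrum γ = Metric.sphere (0 : EuclideanSpace ℝ (Fin d)) 1 ∧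
    -- the signature of the localizer, formed with `γ` itself
    (∀ x : EuclideanSpace ℝ (Fin d),
      (‖x‖ < 1 → CliffordSpec.signature (CliffordSpec.localizer γ γ x)
          (CliffordSpec.localizer_isHermitian hγ.isHermitian hγ.isHermitian x) =
            (Nat.choose (d - 1) ((d - 1) / 2) : ℤ)) ∧
      (1 < ‖x‖ → CliffordSpec.signature (CliffordSpec.localizer γ γ x)
          (CliffordSpec.localizer_isHermitian hγ.isHermitian hγ.isHermitian x) = 0)) ∧
    -- the signature of the localizer, formed with an irreducible representation of the same sign
    (∀ (r : ℕ) (ρ : Fin d → Matrix (Fin r) (Fin r) ℂ) (hρ : CliffordSpec.IsIrredCliffordRep ρ)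
      (ε : ℂ), CliffordSpec.HasCliffordSign γ ε → CliffordSpec.HasCliffordSign ρ ε →
      ∀ x : EuclideanSpace ℝ (Fin d),
        (‖x‖ < 1 → CliffordSpec.signature (CliffordSpec.localizer ρ γ x)
            (CliffordSpec.localizer_isHermitian hρ.isHermitian hγ.isHermitian x) =
              (Nat.choose (d - 1) ((d - 1) / 2) : ℤ)) ∧
        (1 < ‖x‖ → CliffordSpec.signature (CliffordSpec.localizer ρ γ x)
            (CliffordSpec.localizer_isHermitian hρ.isHermitian hγ.isHermitian x) = 0)) := by
  obtain ⟨m, rfl⟩ := hodd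
  have hm : 0 < m := by omega
  have hsub : 2 * m + 1 - 1 = 2 * m := by omega
  have hdiv : 2 * m / 2 = m := by omega
  simp only [hsub, hdiv]
  obtain ⟨ε, hε⟩ := hγ.exists_sign
  exact ⟨CliffordSpec.cliffordSpectrum_eq_sphere hm hγ,
    fun x => CliffordSpec.signature_localizer hm hγ hγ hε hε x _,
    fun r ρ hρ ε hγε hρε x => CliffordSpec.signature_localizer hm hγ hρ hγε hρε x _⟩
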